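/- Let $G$ be a Polish group acting transitively and (jointly) continuously on a Polish space $X$, and let $\phi\colon X\to H$ be a function with values in a Polish group $H$ that is Baire measurable, i.e., $\phi^{-1}(U)$ has the Baire property for every open $U\subseteq H$. Define the differential $d\phi\colon G\times X\to H$ by $$d\phi(g,x)=\phi(gx)^{-1}\phi(x)$$ and, for $g\in G$, the directional differential $d_g\phi\colon X\to H$ by $d_g\phi(x)=d\phi(g,x)$; the operators $\phi\mapsto d_g\phi$ may be iterated. Then the following conditions are equivalent. \begin{enumerate} \item $\phi$ is continuous; \item $d\phi\colon G\times X\to H$ is (jointly) continuous; \item there is a comeagre set of $g\in G$ such that $d_g\phi$ is continuous; \item for every proper subgroup $F<G$, there is some $g\in G\setminus F$ such that $d_g\phi$ is continuous; \item for every infinite sequence $g_1,g_2,\ldots\in G$, there is some $n\geq 1$ such that $d_{g_n}d_{g_{n-1}}\cdots d_{g_1}\phi$ is continuous. \end{enumerate} -/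

import Mathlib

/-- A function between topological spaces is Baire measurable if the preimage of every open set has
the Baire property. -/
def IsBaireMeasurableMap {X Y : Type*} [TopologicalSpace X] [TopologicalSpace Y]
    (f : X → Y) : Prop :=
  ∀ U : Set Y, IsOpen U → BaireMeasurableSet (f ⁻¹' U)

/-- The differential `dφ : G × X → H`, `dφ (g, x) = φ (g x)⁻¹ φ x`. -/
def differential (G : Type*) {X H : Type*} [Group G] [MulAction G X] [Group H]
    (φ : X → H) : G × X → H :=
  fun p => (φ (p.1 • p.2))⁻¹ * φ p.2

/-- The directional differential `d_g φ : X → H`, the section of `dφ` at `g`. -/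
def dirDifferential {G X H : Type*} [Group G] [MulAction G X] [Group H]
    (g : G) (φ : X → H) : X → H :=
  fun x => differential G φ (g, x)

/-- The iterated differential along a sequence whose entries `g 0, g 1, …` are the
directions `g₁, g₂, …`: `iteratedDifferential g φ n` is `d_{gₙ} ⋯ d_{g₁} φ`
(with `d_{g₁}` applied first). -/
def iteratedDifferential {G X H : Type*} [Group G] [MulAction G X] [Group H]
    (g : ℕ → G) (φ : X → H) : ℕ → X → H
  | 0 => φ
  | n + 1 => dirDifferential (g n) (iteratedDifferential g φ n)

/-!
Writing `D` for the set of `g` with `d_g φ` continuous, the cocycle identity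
`d_{gh} φ x = d_g φ (h x) * d_h φ x` makes `D` a subgroup of `G`. A comeagre subgroup of a Baire
group is the whole group, so comeagreness of `D` forces `D = G`, and so does the condition that
no proper subgroup contains `D`.

If `D = G`, then `φ` is continuous. The Baire measurability of `φ` yields a comeagre set `S ⊆ X` on
which `φ` is continuous. Let `xₙ → x`. For each of the countably many points `y = x, x₀, x₁, …`, the
set `{g | g y ∈ S}` is comeagre (`tendsto_smul_residual`), so one `g` moves all of these points into
`S`. Then `φ (g xₙ) → φ (g x)`, and `φ (y) = φ (g y) * d_g φ (y)` gives `φ xₙ → φ x`.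

The fact on `{g | g y ∈ S}` is where transitivity enters. One would usually quote Effros' theorem
(openness of orbit maps), but it follows more cheaply: a Kuratowski–Ulam argument gives it for
comeagrely many `y`, hence for one `y`, and right translations of `G` then carry it to all points
of the orbit.

Finally, if `φ` is not continuous then some `d_g φ` is not continuous, by the above, and `d_g φ`
is again Baire measurable. Iterating this produces a sequence `g₁, g₂, …` along which no iterated
differential is continuous.
-/

open Filter Topology Set

/-! ### Baire measurable maps -/

/-- Baire measurability of a map is measurability from the σ-algebra of sets with the Baire
property to the Borel σ-algebra, so that the measurability library applies. -/
theorem isBaireMeasurableMap_iff_eventuallyMeasurable {X Y : Type*} [TopologicalSpace X]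
    [TopologicalSpace Y] [MeasurableSpace Y] [BorelSpace Y] {f : X → Y} :
    IsBaireMeasurableMap f ↔ EventuallyMeasurable (borel X) (residual X) f := by
  constructor
  · intro hf
    let _ : MeasurableSpace X := eventuallyMeasurableSpace (borel X) (residual X)
    exact measurable_of_isOpen hf
  · exact fun hf U hU => hf hU.measurableSet

theorem IsBaireMeasurableMap.comp_homeomorph {X X' Y : Type*} [TopologicalSpace X]
    [TopologicalSpace X'] [TopologicalSpace Y] {f : X → Y} (hf : IsBaireMeasurableMap f)
    (e : X' ≃ₜ X) : IsBaireMeasurableMap (f ∘ e) := fun U hU =>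
  (hf U hU).preimage e.continuous e.isOpenMap

theorem IsBaireMeasurableMap.inv_mul {X H : Type*} [TopologicalSpace X] [Group H]
    [TopologicalSpace H] [IsTopologicalGroup H] [SecondCountableTopology H] {f k : X → H}
    (hf : IsBaireMeasurableMap f) (hk : IsBaireMeasurableMap k) :
    IsBaireMeasurableMap fun x => (f x)⁻¹ * k x := by
  borelize H
  rw [isBaireMeasurableMap_iff_eventuallyMeasurable] at *
  let _ : MeasurableSpace X := eventuallyMeasurableSpace (borel X) (residual X)
  exact Measurable.mul (Measurable.inv hf) hk

theorem IsBaireMeasurableMap.dirDifferential {G X H : Type*} [Group G] [TopologicalSpace X]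
    [MulAction G X] [ContinuousConstSMul G X] [Group H] [TopologicalSpace H]
    [IsTopologicalGroup H] [SecondCountableTopology H] {φ : X → H}
    (hφ : IsBaireMeasurableMap φ) (g : G) : IsBaireMeasurableMap (dirDifferential g φ) :=
  (hφ.comp_homeomorph (Homeomorph.smul g)).inv_mul hφ

theorem IsBaireMeasurableMap.exists_residual_continuousOn {X Y : Type*} [TopologicalSpace X]
    [TopologicalSpace Y] [SecondCountableTopology Y] {f : X → Y} (hf : IsBaireMeasurableMap f) :
    ∃ S ∈ residual X, ContinuousOn f S := by
  have hB := TopologicalSpace.isBasis_countableBasis Y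
  have hopen : ∀ U : TopologicalSpace.countableBasis Y,
      ∃ O : Set X, IsOpen O ∧ f ⁻¹' U =ᶠ[residual X] O := fun U =>
    (hf U (hB.isOpen U.2)).residualEq_isOpen
  choose O hO hfO using hopen
  have hS : ∀ᶠ x in residual X, ∀ U : TopologicalSpace.countableBasis Y,
      f x ∈ (U : Set Y) ↔ x ∈ O U :=
    eventually_countable_forall.2 fun U => eventuallyEq_set.1 (hfO U)
  refine ⟨_, hS, fun x hx => ?_⟩
  rw [ContinuousWithinAt, hB.nhds_hasBasis.tendsto_right_iff]
  rintro U ⟨hU, hxU⟩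
  have hxO : x ∈ O ⟨U, hU⟩ := (hx ⟨U, hU⟩).1 hxU
  filter_upwards [mem_nhdsWithin_of_mem_nhds ((hO ⟨U, hU⟩).mem_nhds hxO), self_mem_nhdsWithin]
    with y hyO hyS
  exact (hyS ⟨U, hU⟩).2 hyO

/-! ### Category and group actions -/

/-- Kuratowski–Ulam for the action map `(g, x) ↦ g • x` and a dense open set: for a basic open
`V ⊆ G`, the points `x` with `g • x ∈ U` for some `g ∈ V` form the dense open set `V⁻¹ • U`. -/
theorem eventually_residual_smul_mem_of_isOpen {G X : Type*} [Group G] [TopologicalSpace G]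
    [SecondCountableTopology G] [TopologicalSpace X] [MulAction G X] [ContinuousSMul G X]
    {U : Set X} (hU : IsOpen U) (hd : Dense U) :
    ∀ᶠ x in residual X, ∀ᶠ g in residual G, g • x ∈ U := by
  have hB := TopologicalSpace.isBasis_countableBasis G
  have key : ∀ᶠ x in residual X, ∀ V : TopologicalSpace.countableBasis G,
      ∃ g ∈ (V : Set G), g • x ∈ U := by
    refine eventually_countable_forall.2 fun V => ?_
    obtain ⟨g₀, hg₀⟩ := TopologicalSpace.nonempty_of_mem_countableBasis V.2
    have hset : {x : X | ∃ g ∈ (V : Set G), g • x ∈ U} = ⋃ g ∈ (V : Set G), (g • ·) ⁻¹' U := by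
      ext; simp
    refine residual_of_dense_open ?_ ?_
    · rw [hset]
      exact isOpen_biUnion fun g _ => hU.preimage (continuous_const_smul g)
    · exact (hd.preimage (Homeomorph.smul g₀).isOpenMap).mono fun x hx => ⟨g₀, hg₀, hx⟩
  filter_upwards [key] with x hx
  refine residual_of_dense_open (hU.preimage (continuous_id.smul continuous_const)) ?_
  refine hB.dense_iff.2 fun V hV _ => ?_
  obtain ⟨g, hgV, hgU⟩ := hx ⟨V, hV⟩
  exact ⟨g, hgV, hgU⟩

theorem eventually_residual_smul_mem {G X : Type*} [Group G] [TopologicalSpace G]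
    [SecondCountableTopology G] [TopologicalSpace X] [MulAction G X] [ContinuousSMul G X]
    {S : Set X} (hS : S ∈ residual X) :
    ∀ᶠ x in residual X, ∀ᶠ g in residual G, g • x ∈ S := by
  obtain ⟨T, hTo, hTd, hTc, hTS⟩ := mem_residual_iff.1 hS
  have : ∀ᶠ x in residual X, ∀ U ∈ T, ∀ᶠ g in residual G, g • x ∈ U :=
    (eventually_countable_ball hTc).2 fun U hU =>
      eventually_residual_smul_mem_of_isOpen (hTo U hU) (hTd U hU)
  filter_upwards [this] with x hx
  filter_upwards [(eventually_countable_ball hTc).2 hx] with g hg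
  exact hTS (mem_sInter.2 hg)

/-- For a transitive action, the preimage of a comeagre set under any orbit map is comeagre. -/
theorem tendsto_smul_residual {G X : Type*} [Group G] [TopologicalSpace G]
    [IsTopologicalGroup G] [SecondCountableTopology G] [TopologicalSpace X] [BaireSpace X]
    [MulAction G X] [ContinuousSMul G X] [MulAction.IsPretransitive G X] (x : X) :
    Tendsto (fun g : G => g • x) (residual G) (residual X) := by
  intro S hS
  have : Nonempty X := ⟨x⟩
  obtain ⟨x₀, hx₀⟩ :=
    (dense_of_mem_residual (eventually_residual_smul_mem (G := G) hS)).nonempty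
  obtain ⟨h, rfl⟩ := MulAction.exists_smul_eq G x₀ x
  have hh : Tendsto (fun g : G => g * h) (residual G) (residual G) :=
    tendsto_residual_of_isOpenMap (continuous_mul_const h) (isOpenMap_mul_right h)
  change ∀ᶠ g in residual G, g • h • x₀ ∈ S
  filter_upwards [hh.eventually hx₀] with g hg
  rwa [← mul_smul]

theorem Subgroup.eq_top_of_mem_residual {G : Type*} [Group G] [TopologicalSpace G]
    [IsTopologicalGroup G] [BaireSpace G] {F : Subgroup G} (hF : (F : Set G) ∈ residual G) :
    F = ⊤ := by
  refine (Subgroup.eq_top_iff' F).2 fun g => ?_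
  have hg : Tendsto (fun h : G => g * h) (residual G) (residual G) :=
    tendsto_residual_of_isOpenMap (continuous_const_mul g) (isOpenMap_mul_left g)
  -- `F` and its translate `g⁻¹ F` are comeagre, so they meet.
  obtain ⟨h, hh, hgh⟩ := (dense_of_mem_residual (inter_mem hF (hg hF))).nonempty
  exact (Subgroup.mul_mem_cancel_right F hh).1 hgh

/-! ### Directions of continuous differentiability -/

/-- The subgroup of all directions `g` for which `d_g φ` is continuous. -/
def continuousDirections (G : Type*) {X H : Type*} [Group G] [TopologicalSpace X] [MulAction G X]
    [ContinuousConstSMul G X] [Group H] [TopologicalSpace H] [IsTopologicalGroup H]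
    (φ : X → H) : Subgroup G where
  carrier := {g | Continuous (dirDifferential g φ)}
  one_mem' := by
    have : dirDifferential (1 : G) φ = fun _ => 1 := by
      ext x; simp [dirDifferential, differential]
    simpa only [mem_ofPred_eq, this] using continuous_const
  mul_mem' := by
    intro g h hg hh
    have : dirDifferential (g * h) φ =
        fun x => dirDifferential g φ (h • x) * dirDifferential h φ x := by
      ext x; simp [dirDifferential, differential, mul_smul]
    simp only [mem_ofPred_eq, this] at *
    exact (hg.comp (continuous_const_smul h)).mul hh
  inv_mem' := by
    intro g hg
    have : dirDifferential g⁻¹ φ = fun x => (dirDifferential g φ (g⁻¹ • x))⁻¹ := by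
      ext x; simp [dirDifferential, differential]
    simp only [mem_ofPred_eq, this] at *
    exact (hg.comp (continuous_const_smul g⁻¹)).inv

theorem Continuous.differential {G X H : Type*} [Group G] [TopologicalSpace G]
    [TopologicalSpace X] [MulAction G X] [ContinuousSMul G X] [Group H] [TopologicalSpace H]
    [IsTopologicalGroup H] {φ : X → H} (hφ : Continuous φ) : Continuous (differential G φ) :=
  (hφ.comp continuous_smul).inv.mul (hφ.comp continuous_snd)

theorem Continuous.dirDifferential_of_differential {G X H : Type*} [Group G] [TopologicalSpace G]
    [TopologicalSpace X] [MulAction G X] [Group H] [TopologicalSpace H]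
    {φ : X → H} (hφ : Continuous (_root_.differential G φ)) (g : G) :
    Continuous (dirDifferential g φ) :=
  hφ.comp (Continuous.prodMk_right g)

/-- A form of de Bruijn's difference theorem: a Baire measurable map all of whose directional
differentials are continuous is itself continuous. -/
theorem IsBaireMeasurableMap.continuous_of_forall_dirDifferential {G X H : Type*} [Group G]
    [TopologicalSpace G] [IsTopologicalGroup G] [SecondCountableTopology G] [BaireSpace G]
    [TopologicalSpace X] [BaireSpace X] [FirstCountableTopology X]
    [MulAction G X] [ContinuousSMul G X] [MulAction.IsPretransitive G X]
    [Group H] [TopologicalSpace H] [IsTopologicalGroup H] [SecondCountableTopology H] {φ : X → H}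
    (hφ : IsBaireMeasurableMap φ) (hd : ∀ g : G, Continuous (_root_.dirDifferential g φ)) :
    Continuous φ := by
  obtain ⟨S, hS, hSφ⟩ := hφ.exists_residual_continuousOn
  refine continuous_iff_seqContinuous.2 fun u x hu => ?_
  have hx : ∀ᶠ g : G in residual G, g • x ∈ S := tendsto_smul_residual x hS
  have hun : ∀ᶠ g : G in residual G, ∀ n, g • u n ∈ S :=
    eventually_countable_forall.2 fun n => tendsto_smul_residual (u n) hS
  obtain ⟨g, hgx, hgu⟩ := (dense_of_mem_residual (hx.and hun)).nonempty
  have hsmul : Tendsto (fun n => g • u n) atTop (𝓝[S] (g • x)) :=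
    tendsto_nhdsWithin_iff.2 ⟨hu.const_smul g, Eventually.of_forall hgu⟩
  have hmain := ((hSφ _ hgx).tendsto.comp hsmul).mul (((hd g).tendsto x).comp hu)
  simpa [Function.comp_def, _root_.dirDifferential, _root_.differential] using hmain

/-- If `φ` is Baire measurable and discontinuous, there is a sequence along which all iterated
differentials are discontinuous. -/
theorem IsBaireMeasurableMap.exists_forall_not_continuous_iteratedDifferential {G X H : Type*}
    [Group G] [TopologicalSpace G] [IsTopologicalGroup G] [SecondCountableTopology G]
    [BaireSpace G] [TopologicalSpace X] [BaireSpace X] [FirstCountableTopology X]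
    [MulAction G X] [ContinuousSMul G X] [MulAction.IsPretransitive G X]
    [Group H] [TopologicalSpace H] [IsTopologicalGroup H] [SecondCountableTopology H] {φ : X → H}
    (hφ : IsBaireMeasurableMap φ) (hc : ¬ Continuous φ) :
    ∃ g : ℕ → G, ∀ n, ¬ Continuous (iteratedDifferential g φ n) := by
  have step : ∀ ψ : {ψ : X → H // IsBaireMeasurableMap ψ ∧ ¬ Continuous ψ},
      ∃ g : G, ¬ Continuous (_root_.dirDifferential g ψ.1) := by
    intro ψ
    by_contra! h
    exact ψ.2.2 (ψ.2.1.continuous_of_forall_dirDifferential h)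
  choose d hd using step
  let ψ : ℕ → {ψ : X → H // IsBaireMeasurableMap ψ ∧ ¬ Continuous ψ} := fun n =>
    Nat.rec ⟨φ, hφ, hc⟩ (fun _ χ => ⟨_root_.dirDifferential (d χ) χ.1,
      χ.2.1.dirDifferential (d χ), hd χ⟩) n
  have hψ : ∀ n, iteratedDifferential (fun n => d (ψ n)) φ n = (ψ n).1 := by
    intro n
    induction n with
    | zero => rfl
    | succ n ih => rw [iteratedDifferential, ih]
  exact ⟨fun n => d (ψ n), fun n => (hψ n).symm ▸ (ψ n).2.2⟩

theorem theorem2 {G X H : Type*}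
    [Group G] [TopologicalSpace G] [IsTopologicalGroup G] [PolishSpace G]
    [TopologicalSpace X] [PolishSpace X]
    [MulAction G X] [ContinuousSMul G X] [MulAction.IsPretransitive G X]
    [Group H] [TopologicalSpace H] [IsTopologicalGroup H] [PolishSpace H]
    (φ : X → H) (hφ : IsBaireMeasurableMap φ) :
    List.TFAE
      [Continuous φ,
       Continuous (differential G φ),
       ∃ S : Set G, S ∈ residual G ∧ ∀ g ∈ S, Continuous (dirDifferential g φ),
       ∀ F : Subgroup G, F ≠ ⊤ → ∃ g : G, g ∉ F ∧ Continuous (dirDifferential g φ),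
       ∀ g : ℕ → G, ∃ n : ℕ, 1 ≤ n ∧ Continuous (iteratedDifferential g φ n)] := by
  tfae_have 1 → 2 := fun h => h.differential
  tfae_have 2 → 3 := fun h => ⟨univ, univ_mem, fun g _ => h.dirDifferential_of_differential g⟩
  tfae_have 3 → 4 := by
    rintro ⟨S, hS, hSc⟩ F hF
    by_contra! hcon
    refine hF (Subgroup.eq_top_of_mem_residual (mem_of_superset hS fun g hg => ?_))
    by_contra hgF
    exact hcon g hgF (hSc g hg)
  tfae_have 4 → 1 := by
    intro h
    have htop : continuousDirections G φ = ⊤ := by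
      by_contra hne
      obtain ⟨g, hg, hgc⟩ := h _ hne
      exact hg hgc
    exact hφ.continuous_of_forall_dirDifferential ((Subgroup.eq_top_iff' _).1 htop)
  tfae_have 1 → 5 := fun h g =>
    ⟨1, le_rfl, h.differential.dirDifferential_of_differential (g 0)⟩
  tfae_have 5 → 1 := by
    intro h
    by_contra hc
    obtain ⟨g, hg⟩ := hφ.exists_forall_not_continuous_iteratedDifferential (G := G) hc
    obtain ⟨n, -, hn⟩ := h g
    exact hg n hn
  tfae_finish
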